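/- For $p\in\mathbb N$, a graph $G=(V,E)$ on $V=\{1,\dots,p\}$ and $\lambda>0$, let $P_G$ be the Ising model on $\{-1,1\}^p$ given by $P_G(x)=\frac1Z\exp\big(\lambda\sum_{\{i,j\}\in E}x_ix_j\big)$, where $Z$ is the normalizing constant. An estimator produces, from $n$ independent samples of $P_G$ (and possibly independent randomness of its own), an estimate $\hat E$ of $E$. Let $\mathcal G_k$ be the class of graphs on $V$ with at most $k$ edges, let $P_e(q_{\max})=\max_{G\in\mathcal G_k}\mathbb P_G\big[|E\,\triangle\,\hat E|>q_{\max}\big]$, and let $H_2(x)=-x\log x-(1-x)\log(1-x)$, where $\log$ is the natural logarithm. **Theorem.** Fix $\theta\in(0,\tfrac14)$. There is a sequence $(\eta_k)_{k\ge1}$ of real numbers, depending only on $\theta$, with $\eta_k\to0$ as $k\to\infty$, such that the following holds for all integers $k\ge1$, $p\ge 4k$, $n\ge0$ and all real $\lambda>0$ and $\delta$. If some estimator based on $n$ samples satisfies $P_e(q_{\max})\le\delta$ for the class $\mathcal G_k$ with $q_{\max}=\lfloor\theta k\rfloor$, then $$n\ \ge\ \max\left\{\frac{e^{\lambda(\sqrt{k/2}-2)/2}\,\big(\log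 2-H_2(2\theta)\big)}{6\lambda k},\ \frac{2(1-\theta)\log p}{\lambda\tanh\lambda}\right\}\,(1-\delta-\eta_k).$$ -/

import Mathlib

open Filter Topology

noncomputable section

namespace IsingRecovery

/-- A joint value of the `p` spin variables; `ℤˣ` is the two-point set `{1, -1}`. -/
abbrev Config (p : ℕ) : Type := Fin p → ℤˣ

/-- `n` observations of the `p` spins, one row for each observation. -/
abbrev Samples (n p : ℕ) : Type := Fin n → Config p

open Classical in
/-- The coupling `λ_{ij}`: equal to `lam` on the edges of `G`, and zero elsewhere. -/
def coupling {p : ℕ} (G : SimpleGraph (Fin p)) (lam : ℝ) (i j : Fin p) : ℝ :=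
  if G.Adj i j then lam else 0

/-- The exponent `∑ λ_{ij} x_i x_j`, each unordered pair of vertices being counted once. -/
def exponent {p : ℕ} (G : SimpleGraph (Fin p)) (lam : ℝ) (x : Config p) : ℝ :=
  ∑ i : Fin p, ∑ j ∈ Finset.Ioi i,
    coupling G lam i j * (((x i : ℤ) : ℝ) * ((x j : ℤ) : ℝ))

/-- The partition function `Z`. -/
def partitionFunction {p : ℕ} (G : SimpleGraph (Fin p)) (lam : ℝ) : ℝ :=
  ∑ x : Config p, Real.exp (exponent G lam x)

/-- The probability mass function `P_G` of the Ising model on `G`. -/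
def isingProb {p : ℕ} (G : SimpleGraph (Fin p)) (lam : ℝ) (x : Config p) : ℝ :=
  Real.exp (exponent G lam x) / partitionFunction G lam

/-- The probability mass function of `n` independent samples from `P_G`. -/
def samplesProb {n p : ℕ} (G : SimpleGraph (Fin p)) (lam : ℝ) (X : Samples n p) : ℝ :=
  ∏ t : Fin n, isingProb G lam (X t)

/-- The edit distance `|E Δ E'|` between two graphs. -/
def editDist {p : ℕ} (G H : SimpleGraph (Fin p)) : ℕ :=
  (symmDiff G.edgeSet H.edgeSet).ncard

/-- The class of graphs with at most `k` edges. -/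
def edgeBoundedClass (p k : ℕ) : Set (SimpleGraph (Fin p)) :=
  {G | G.edgeSet.ncard ≤ k}

/-- An estimator of the graph from `n` samples. It may use its own randomness; a deterministic
estimator `f` is the map `fun X => PMF.pure (f X)`. -/
abbrev Estimator (n p : ℕ) : Type := Samples n p → PMF (SimpleGraph (Fin p))

open Classical in
/-- The probability `ℙ[|E Δ Ê| > q]` when the samples are drawn from `P_G`. -/
def errorProb {n p : ℕ} (lam : ℝ) (est : Estimator n p) (q : ℕ) (G : SimpleGraph (Fin p)) : ℝ :=
  ∑ X : Samples n p, samplesProb G lam X *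
    ∑ H : SimpleGraph (Fin p), if q < editDist G H then (est X H).toReal else 0

/-- The worst-case error probability over a class of graphs. -/
def maxErrorProb {n p : ℕ} (𝒢 : Set (SimpleGraph (Fin p))) (lam : ℝ) (est : Estimator n p)
    (q : ℕ) : ℝ :=
  ⨆ G : 𝒢, errorProb lam est q (G : SimpleGraph (Fin p))

end IsingRecovery

end

/-!
# Lower bounds for the approximate recovery of an Ising model

Both bounds come from Fano's inequality (`fano`) for a finite ensemble of graphs: if the Ising
models of the ensemble have relative entropy at most `D` with respect to one reference model, and
`τ` is the logarithm of the ratio between the size of the ensemble and the number of its members in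
the largest ball of radius `q` for the edit distance, then `τ * (1 - δ) ≤ n * D + log 2`. It is
proved by a change of measure: a successful estimate has probability at most `exp (-τ)` on average
when the samples come from the reference model.

* For the bound with `log p`, the ensemble consists of the forests in which each of `k` leaves is
  joined to an arbitrary one of the other `p - k` vertices, and the reference is the empty graph.
  In a forest the products of the spins along the edges are independent, so the relative entropy is
  `k * (lam * tanh lam - log (cosh lam))`, at most `k * lam * tanh lam / 2`
  (`relEntropy_forest_le`). A ball of radius `q ≤ θ * k` has at most `2 ^ k * (p - k) ^ q` members
  (`card_forest_ball_le`), whence `τ ≥ (1 - θ) * k * log p - 2 * k * log 2`.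

* For the exponential bound, the reference is a complete bipartite graph between `a` hubs and
  `2 * b` further vertices `B ∪ C`, and the ensemble adds to it an arbitrary set of the `b ^ 2` pairs
  in `B × C`. Given the hubs, the other spins are independent, so two of them have correlation
  at least `1 - 128 * exp (-2 * lam * a)` (`mean_one_sub_spin_mul_spin_le`), and the added
  edges change the model little: `D ≤ 128 * lam * b ^ 2 * exp (-2 * lam * a)`
  (`relEntropy_le_of_pairs_eq_union`). The ensemble is a Hamming cube, in which the entropy bound
  for balls (`card_filter_card_le_exp`) gives `τ = b ^ 2 * (log 2 - H₂ (2 * θ))` as soon as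
  `b ^ 2 ≥ k / 2`. With `b` about `√(k / 2)` and `a` about `b / 4`, all graphs have at most `k`
  edges once `k ≥ 200`.

The sequence `η` collects the terms of lower order, and is at least `1` for `k < 200`.
-/

noncomputable section

namespace IsingRecovery

/-! ### Graphs as sets of ordered pairs -/

open Classical in
/-- The edges of `G`, each written as the ordered pair `(i, j)` of its ends with `i < j`. -/
def pairs {p : ℕ} (G : SimpleGraph (Fin p)) : Finset (Fin p × Fin p) :=
  Finset.univ.filter fun e => e.1 < e.2 ∧ G.Adj e.1 e.2

/-- The graph whose edges are the pairs in `T`. -/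
def ofPairs {p : ℕ} (T : Finset (Fin p × Fin p)) : SimpleGraph (Fin p) :=
  SimpleGraph.fromRel fun i j => (i, j) ∈ T

theorem mem_pairs {p : ℕ} (G : SimpleGraph (Fin p)) (e : Fin p × Fin p) :
    e ∈ pairs G ↔ e.1 < e.2 ∧ G.Adj e.1 e.2 := by
  simp [pairs]

theorem pairs_ofPairs {p : ℕ} {T : Finset (Fin p × Fin p)} (hT : ∀ e ∈ T, e.1 < e.2) :
    pairs (ofPairs T) = T := by
  ext ⟨i, j⟩
  simp only [mem_pairs, ofPairs, SimpleGraph.fromRel_adj]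
  constructor
  · rintro ⟨hij, -, h | h⟩
    · exact h
    · exact absurd (hT _ h) (not_lt.mpr hij.le)
  · exact fun h => ⟨hT _ h, (hT _ h).ne, Or.inl h⟩

theorem image_mk_symmDiff_pairs {p : ℕ} (G H : SimpleGraph (Fin p)) :
    symmDiff G.edgeSet H.edgeSet =
      (fun e : Fin p × Fin p => s(e.1, e.2)) '' ↑(symmDiff (pairs G) (pairs H)) := by
  ext e
  induction e using Sym2.ind with
  | _ i j =>
    simp only [Set.mem_symmDiff, SimpleGraph.mem_edgeSet, Set.mem_image, Finset.mem_coe,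
      Finset.mem_symmDiff, mem_pairs, Prod.exists, Sym2.eq_iff]
    constructor
    · intro h
      have hne : i ≠ j := by
        rintro rfl
        simp at h
      rcases lt_or_gt_of_ne hne with hlt | hlt
      · exact ⟨i, j, by tauto, by simp⟩
      · exact ⟨j, i, by rw [G.adj_comm, H.adj_comm]; tauto, by simp⟩
    · rintro ⟨a, b, h, ⟨rfl, rfl⟩ | ⟨rfl, rfl⟩⟩
      · tauto
      · rw [G.adj_comm, H.adj_comm]; tauto

theorem mk_injOn_lt {p : ℕ} :
    Set.InjOn (fun e : Fin p × Fin p => s(e.1, e.2)) {e | e.1 < e.2} := by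
  rintro ⟨a, b⟩ h ⟨c, d⟩ h' heq
  simp only [Set.mem_ofPred_eq, Sym2.eq_iff] at h h' heq
  rcases heq with ⟨rfl, rfl⟩ | ⟨rfl, rfl⟩
  · rfl
  · exact absurd h (not_lt.mpr h'.le)

theorem editDist_eq_card {p : ℕ} (G H : SimpleGraph (Fin p)) :
    editDist G H = (symmDiff (pairs G) (pairs H)).card := by
  rw [editDist, image_mk_symmDiff_pairs, Set.InjOn.ncard_image, Set.ncard_coe_finset]
  refine mk_injOn_lt.mono fun e he => ?_
  simp only [Finset.mem_coe, Finset.mem_symmDiff, mem_pairs] at he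
  simp only [Set.mem_ofPred_eq]
  tauto

theorem ncard_edgeSet_eq_card {p : ℕ} (G : SimpleGraph (Fin p)) :
    G.edgeSet.ncard = (pairs G).card := by
  have h := editDist_eq_card G ⊥
  have hbot : pairs (⊥ : SimpleGraph (Fin p)) = ∅ := by
    ext e
    simp [mem_pairs]
  rwa [editDist, hbot, SimpleGraph.edgeSet_bot, ← Set.bot_eq_empty, ← Finset.bot_eq_empty,
    symmDiff_bot, symmDiff_bot] at h

/-- The value of the spin `i` in the configuration `x`, as a real number. -/
def spin {p : ℕ} (x : Config p) (i : Fin p) : ℝ := ((x i : ℤ) : ℝ)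

theorem exponent_eq_sum_pairs {p : ℕ} (G : SimpleGraph (Fin p)) (lam : ℝ) (x : Config p) :
    exponent G lam x = lam * ∑ e ∈ pairs G, spin x e.1 * spin x e.2 := by
  classical
  rw [exponent, pairs, Finset.sum_filter, Finset.mul_sum, Fintype.sum_prod_type]
  refine Finset.sum_congr rfl fun i _ => ?_
  rw [← Finset.sum_subset (Finset.subset_univ (Finset.Ioi i))]
  · refine Finset.sum_congr rfl fun j hj => ?_
    simp only [coupling, Finset.mem_Ioi.mp hj, true_and, spin]
    split_ifs <;> ring
  · intro j _ hj
    have : ¬ i < j := by simpa using hj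
    simp [this]

theorem partitionFunction_pos {p : ℕ} (G : SimpleGraph (Fin p)) (lam : ℝ) :
    0 < partitionFunction G lam :=
  Finset.sum_pos (fun _ _ => Real.exp_pos _) Finset.univ_nonempty

theorem isingProb_pos {p : ℕ} (G : SimpleGraph (Fin p)) (lam : ℝ) (x : Config p) :
    0 < isingProb G lam x :=
  div_pos (Real.exp_pos _) (partitionFunction_pos G lam)

theorem sum_isingProb {p : ℕ} (G : SimpleGraph (Fin p)) (lam : ℝ) :
    ∑ x, isingProb G lam x = 1 := by
  simp only [isingProb, ← Finset.sum_div]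
  exact div_self (partitionFunction_pos G lam).ne'

/-! ### Fano's inequality for approximate recovery -/

theorem sum_prod_mul_apply {α : Type*} [Fintype α] {n : ℕ} {P : α → ℝ} (hP : ∑ a, P a = 1)
    (g : α → ℝ) (s : Fin n) :
    ∑ X : Fin n → α, (∏ t, P (X t)) * g (X s) = ∑ a, P a * g a := by
  classical
  have h := Finset.prod_univ_sum (fun _ : Fin n => (Finset.univ : Finset α))
    (fun t a => if t = s then P a * g a else P a)
  rw [Fintype.piFinset_univ] at h
  have hl : ∏ t : Fin n, ∑ a, (if t = s then P a * g a else P a) = ∑ a, P a * g a := by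
    rw [Finset.prod_eq_single s]
    · simp
    · intro t _ ht
      simp [ht, hP]
    · simp
  rw [← hl, h]
  refine Finset.sum_congr rfl fun X _ => ?_
  rw [← Finset.mul_prod_erase Finset.univ _ (Finset.mem_univ s),
    ← Finset.mul_prod_erase Finset.univ (fun t => if t = s then _ else _) (Finset.mem_univ s),
    if_pos rfl]
  rw [Finset.prod_congr rfl (g := fun t => P (X t))
    (fun t ht => if_neg (Finset.ne_of_mem_erase ht))]
  ring

theorem sum_prod_eq_one {α : Type*} [Fintype α] {n : ℕ} {P : α → ℝ} (hP : ∑ a, P a = 1) :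
    ∑ X : Fin n → α, ∏ t, P (X t) = 1 := by
  classical
  have h := Finset.prod_univ_sum (fun _ : Fin n => (Finset.univ : Finset α)) (fun _ a => P a)
  rw [Fintype.piFinset_univ] at h
  rw [← h]
  simp [hP]

theorem samplesProb_pos {n p : ℕ} (G : SimpleGraph (Fin p)) (lam : ℝ) (X : Samples n p) :
    0 < samplesProb G lam X :=
  Finset.prod_pos fun _ _ => isingProb_pos G lam _

theorem sum_samplesProb {p : ℕ} (n : ℕ) (G : SimpleGraph (Fin p)) (lam : ℝ) :
    ∑ X : Samples n p, samplesProb G lam X = 1 :=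
  sum_prod_eq_one (sum_isingProb G lam)

/-- The relative entropy `D(P_G ‖ P_Q)` of two Ising models. -/
def relEntropy {p : ℕ} (G Q : SimpleGraph (Fin p)) (lam : ℝ) : ℝ :=
  ∑ x, isingProb G lam x * Real.log (isingProb G lam x / isingProb Q lam x)

/-- Relative entropy is additive over independent samples. -/
theorem sum_samplesProb_mul_log {p : ℕ} (n : ℕ) (G Q : SimpleGraph (Fin p)) (lam : ℝ) :
    ∑ X : Samples n p, samplesProb G lam X *
      Real.log (samplesProb G lam X / samplesProb Q lam X) = n * relEntropy G Q lam := by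
  have hlog : ∀ X : Samples n p, Real.log (samplesProb G lam X / samplesProb Q lam X) =
      ∑ t, Real.log (isingProb G lam (X t) / isingProb Q lam (X t)) := by
    intro X
    rw [samplesProb, samplesProb, ← Finset.prod_div_distrib, Real.log_prod]
    exact fun t _ => (div_pos (isingProb_pos G lam _) (isingProb_pos Q lam _)).ne'
  simp only [hlog, Finset.mul_sum]
  rw [Finset.sum_comm]
  simp only [samplesProb]
  rw [Finset.sum_congr rfl fun t _ => sum_prod_mul_apply (sum_isingProb G lam)
    (fun a => Real.log (isingProb G lam a / isingProb Q lam a)) t]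
  simp [relEntropy]

open Classical in
/-- The conditional probability, given the samples `X`, that the estimate is within edit distance
`q` of `G`. -/
def successProb {n p : ℕ} (est : Estimator n p) (q : ℕ) (G : SimpleGraph (Fin p))
    (X : Samples n p) : ℝ :=
  ∑ H : SimpleGraph (Fin p), if editDist G H ≤ q then (est X H).toReal else 0

theorem sum_toReal_pmf {α : Type*} [Fintype α] (μ : PMF α) : ∑ a, (μ a).toReal = 1 := by
  rw [← ENNReal.toReal_sum fun a _ => μ.apply_ne_top a, ← tsum_fintype (L := .unconditional α),
    μ.tsum_coe, ENNReal.toReal_one]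

theorem successProb_nonneg {n p : ℕ} (est : Estimator n p) (q : ℕ) (G : SimpleGraph (Fin p))
    (X : Samples n p) : 0 ≤ successProb est q G X :=
  Finset.sum_nonneg fun H _ => by split_ifs <;> simp

theorem successProb_le_one {n p : ℕ} (est : Estimator n p) (q : ℕ) (G : SimpleGraph (Fin p))
    (X : Samples n p) : successProb est q G X ≤ 1 := by
  classical
  rw [← sum_toReal_pmf (est X)]
  exact Finset.sum_le_sum fun H _ => by split_ifs <;> simp

theorem errorProb_nonneg {n p : ℕ} (lam : ℝ) (est : Estimator n p) (q : ℕ)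
    (G : SimpleGraph (Fin p)) : 0 ≤ errorProb lam est q G :=
  Finset.sum_nonneg fun X _ => mul_nonneg (samplesProb_pos G lam X).le
    (Finset.sum_nonneg fun H _ => by split_ifs <;> simp)

theorem errorProb_eq_one_sub {n p : ℕ} (lam : ℝ) (est : Estimator n p) (q : ℕ)
    (G : SimpleGraph (Fin p)) :
    errorProb lam est q G = 1 - ∑ X, samplesProb G lam X * successProb est q G X := by
  classical
  rw [← sum_samplesProb n G lam, ← Finset.sum_sub_distrib]
  refine Finset.sum_congr rfl fun X _ => ?_
  rw [← mul_one_sub, ← sum_toReal_pmf (est X), successProb, ← Finset.sum_sub_distrib]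
  congr 1
  refine Finset.sum_congr rfl fun H _ => ?_
  by_cases h : editDist G H ≤ q
  · simp [h, not_lt.mpr h]
  · simp [h, not_le.mp h]

theorem errorProb_le_maxErrorProb {n p : ℕ} {𝒢 : Set (SimpleGraph (Fin p))} (lam : ℝ)
    (est : Estimator n p) (q : ℕ) {G : SimpleGraph (Fin p)} (hG : G ∈ 𝒢) :
    errorProb lam est q G ≤ maxErrorProb 𝒢 lam est q :=
  le_ciSup (f := fun G : 𝒢 => errorProb lam est q (G : SimpleGraph (Fin p)))
    (Set.finite_range _).bddAbove ⟨G, hG⟩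

/-- The pointwise inequality `P (φ - log (P / Q) - log c) ≤ Q e ^ φ / c - P` that underlies the
variational formula for relative entropy. -/
theorem mul_sub_log_le {P Q c : ℝ} (hP : 0 < P) (hQ : 0 < Q) (hc : 0 < c) (φ : ℝ) :
    P * φ - P * Real.log (P / Q) - P * Real.log c ≤ Q * Real.exp φ / c - P := by
  have h := Real.log_le_sub_one_of_pos (x := Q * Real.exp φ / (c * P)) (by positivity)
  rw [Real.log_div (by positivity) (by positivity), Real.log_mul hQ.ne' (Real.exp_pos _).ne',
    Real.log_exp, Real.log_mul hc.ne' hP.ne'] at h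
  rw [Real.log_div hP.ne' hQ.ne']
  have h2 := mul_le_mul_of_nonneg_left h hP.le
  have h3 : P * (Q * Real.exp φ / (c * P) - 1) = Q * Real.exp φ / c - P := by
    field_simp
  linarith

theorem exp_mul_le_one_add {f : ℝ} (h0 : 0 ≤ f) (h1 : f ≤ 1) (τ : ℝ) :
    Real.exp (τ * f) ≤ 1 + f * (Real.exp τ - 1) := by
  have h := convexOn_exp.2 (Set.mem_univ (0 : ℝ)) (Set.mem_univ τ) (sub_nonneg.mpr h1) h0
    (by ring)
  simp only [smul_eq_mul, mul_zero, zero_add, Real.exp_zero, mul_one] at h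
  rw [mul_comm τ f]
  linarith

/-- Change of measure from `P_Q` to `P_G` for the event of a successful estimate. -/
theorem mul_one_sub_errorProb_le {n p : ℕ} (lam : ℝ) (est : Estimator n p) (q : ℕ)
    (G Q : SimpleGraph (Fin p)) (τ : ℝ) :
    τ * (1 - errorProb lam est q G) ≤ n * relEntropy G Q lam + Real.log 2 +
      (((Real.exp τ - 1) * ∑ X, samplesProb Q lam X * successProb est q G X) - 1) / 2 := by
  have key : ∀ X : Samples n p,
      τ * (samplesProb G lam X * successProb est q G X) -
        samplesProb G lam X * Real.log (samplesProb G lam X / samplesProb Q lam X) -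
        samplesProb G lam X * Real.log 2 ≤
      (samplesProb Q lam X + (Real.exp τ - 1) * (samplesProb Q lam X * successProb est q G X)) / 2
        - samplesProb G lam X := by
    intro X
    have h := mul_sub_log_le (samplesProb_pos G lam X) (samplesProb_pos Q lam X) two_pos
      (τ * successProb est q G X)
    have h2 := mul_le_mul_of_nonneg_left
      (exp_mul_le_one_add (successProb_nonneg est q G X) (successProb_le_one est q G X) τ)
      (samplesProb_pos Q lam X).le
    linarith
  have hsum := Finset.sum_le_sum fun X (_ : X ∈ Finset.univ) => key X
  simp only [Finset.sum_sub_distrib, ← Finset.sum_div, Finset.sum_add_distrib, ← Finset.mul_sum,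
    ← Finset.sum_mul, sum_samplesProb, sum_samplesProb_mul_log] at hsum
  rw [errorProb_eq_one_sub]
  linarith

open Classical in
/-- **Fano's inequality** for recovery up to edit distance `q`. For a finite family of graphs whose
models are within relative entropy `D` of a common one, `τ` is the logarithm of the ratio between
the size of the family and the largest number of its members in a ball of radius `q`. -/
theorem fano {ι : Type*} {n p : ℕ} {lam δ D τ : ℝ} {est : Estimator n p} {q : ℕ} {s : Finset ι}
    (hs : s.Nonempty) (G : ι → SimpleGraph (Fin p)) (Q : SimpleGraph (Fin p)) (hτ : 0 ≤ τ)
    (herr : ∀ m ∈ s, errorProb lam est q (G m) ≤ δ)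
    (hD : ∀ m ∈ s, relEntropy (G m) Q lam ≤ D)
    (hball : ∀ H, ((s.filter fun m => editDist (G m) H ≤ q).card : ℝ) ≤
      s.card * Real.exp (-τ)) :
    τ * (1 - δ) ≤ n * D + Real.log 2 := by
  have hQ : ∑ m ∈ s, ∑ X, samplesProb Q lam X * successProb est q (G m) X ≤
      s.card * Real.exp (-τ) := by
    rw [Finset.sum_comm]
    calc ∑ X, ∑ m ∈ s, samplesProb Q lam X * successProb est q (G m) X
        ≤ ∑ X, samplesProb Q lam X * (s.card * Real.exp (-τ)) := by
          refine Finset.sum_le_sum fun X _ => ?_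
          rw [← Finset.mul_sum]
          refine mul_le_mul_of_nonneg_left ?_ (samplesProb_pos Q lam X).le
          simp only [successProb]
          rw [Finset.sum_comm]
          calc ∑ H, ∑ m ∈ s, (if editDist (G m) H ≤ q then (est X H).toReal else 0)
              ≤ ∑ H, (s.card * Real.exp (-τ)) * (est X H).toReal := by
                refine Finset.sum_le_sum fun H _ => ?_
                rw [← Finset.sum_filter, Finset.sum_const, nsmul_eq_mul]
                exact mul_le_mul_of_nonneg_right (hball H) ENNReal.toReal_nonneg
            _ = s.card * Real.exp (-τ) := by
                rw [← Finset.mul_sum, sum_toReal_pmf, mul_one]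
      _ = s.card * Real.exp (-τ) := by
          rw [← Finset.sum_mul, sum_samplesProb, one_mul]
  have hpos : (0 : ℝ) < s.card := by exact_mod_cast hs.card_pos
  have hm : ∀ m ∈ s, τ * (1 - δ) ≤ n * D + Real.log 2 +
      (((Real.exp τ - 1) * ∑ X, samplesProb Q lam X * successProb est q (G m) X) - 1) / 2 := by
    intro m hmem
    have h1 := mul_one_sub_errorProb_le lam est q (G m) Q τ
    have h2 := mul_le_mul_of_nonneg_left (hD m hmem) (Nat.cast_nonneg (α := ℝ) n)
    have h3 := mul_le_mul_of_nonneg_left (herr m hmem) hτ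
    linarith
  have hsum := Finset.sum_le_sum hm
  simp only [Finset.sum_const, nsmul_eq_mul, Finset.sum_add_distrib, ← Finset.sum_div,
    Finset.sum_sub_distrib, ← Finset.mul_sum] at hsum
  have he : (0 : ℝ) ≤ Real.exp τ - 1 := sub_nonneg.mpr (Real.one_le_exp hτ)
  have h4 := mul_le_mul_of_nonneg_left hQ he
  have h5 : (Real.exp τ - 1) * (s.card * Real.exp (-τ)) ≤ s.card := by
    have : Real.exp τ * Real.exp (-τ) = 1 := by rw [← Real.exp_add]; simp
    nlinarith [Real.exp_pos (-τ)]
  refine le_of_mul_le_mul_left ?_ hpos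
  linarith

/-! ### Ising models: relative entropy and spin flips -/

theorem relEntropy_eq {p : ℕ} (G Q : SimpleGraph (Fin p)) (lam : ℝ) :
    relEntropy G Q lam = ∑ x, isingProb G lam x * (exponent G lam x - exponent Q lam x) -
      Real.log (partitionFunction G lam / partitionFunction Q lam) := by
  have hG := partitionFunction_pos G lam
  have hQ := partitionFunction_pos Q lam
  have h : ∀ x, Real.log (isingProb G lam x / isingProb Q lam x) =
      (exponent G lam x - exponent Q lam x) -
        Real.log (partitionFunction G lam / partitionFunction Q lam) := by
    intro x
    rw [Real.log_div (isingProb_pos G lam x).ne' (isingProb_pos Q lam x).ne', isingProb, isingProb,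
      Real.log_div (Real.exp_pos _).ne' hG.ne', Real.log_div (Real.exp_pos _).ne' hQ.ne',
      Real.log_exp, Real.log_exp, Real.log_div hG.ne' hQ.ne']
    ring
  simp only [relEntropy, h, mul_sub, Finset.sum_sub_distrib]
  rw [← Finset.sum_mul _ _ (Real.log _), sum_isingProb, one_mul]

theorem spin_eq_or {p : ℕ} (x : Config p) (i : Fin p) : spin x i = 1 ∨ spin x i = -1 := by
  rcases Int.units_eq_one_or (x i) with h | h <;> simp [spin, h]

/-- The configuration `x` with the spin `i` reversed. -/
def flip {p : ℕ} (i : Fin p) (x : Config p) : Config p := Function.update x i (-x i)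

theorem flip_involutive {p : ℕ} (i : Fin p) : Function.Involutive (flip i) := by
  intro x
  simp [flip]

theorem spin_flip_self {p : ℕ} (i : Fin p) (x : Config p) : spin (flip i x) i = -spin x i := by
  simp [flip, spin]

theorem spin_flip_of_ne {p : ℕ} {i j : Fin p} (h : j ≠ i) (x : Config p) :
    spin (flip i x) j = spin x j := by
  simp [flip, spin, h]

theorem sum_eq_zero_of_flip {p : ℕ} (i : Fin p) {F : Config p → ℝ}
    (h : ∀ x, F (flip i x) = -F x) : ∑ x, F x = 0 := by
  have h1 := Equiv.sum_comp (flip_involutive i).toPerm F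
  simp only [Function.Involutive.coe_toPerm, h, Finset.sum_neg_distrib] at h1
  linarith

theorem one_add_tanh_mul_exp_neg (h : ℝ) :
    (1 + Real.tanh h) * Real.exp (-h) = (1 - Real.tanh h) * Real.exp h := by
  have hc := Real.cosh_pos h
  rw [Real.tanh_eq_sinh_div_cosh, ← Real.cosh_sub_sinh, ← Real.cosh_add_sinh]
  field_simp

/-- If the local field `h` and the weight `w` do not depend on the spin `i`, then the conditional
mean of this spin given the others is `tanh h`. -/
theorem sum_spin_mul_exp {p : ℕ} (i : Fin p) {h w : Config p → ℝ}
    (hh : ∀ x, h (flip i x) = h x) (hw : ∀ x, w (flip i x) = w x) :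
    ∑ x, spin x i * (Real.exp (spin x i * h x) * w x) =
      ∑ x, Real.tanh (h x) * (Real.exp (spin x i * h x) * w x) := by
  rw [← sub_eq_zero, ← Finset.sum_sub_distrib]
  refine sum_eq_zero_of_flip i fun x => ?_
  have key := one_add_tanh_mul_exp_neg (h x)
  rw [spin_flip_self, hh, hw]
  rcases spin_eq_or x i with hs | hs <;> simp only [hs, one_mul, neg_mul, neg_neg]
  · linear_combination (-w x) * key
  · linear_combination (-w x) * key

/-! ### Star forests -/

/-- The edge that joins the leaf `i < k` to the vertex `k + f i`. -/
def forestEdge {k r : ℕ} (f : Fin k → Fin r) : Fin k ↪ Fin (k + r) × Fin (k + r) where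
  toFun i := (Fin.castAdd r i, Fin.natAdd k (f i))
  inj' _ _ h := Fin.castAdd_injective k r (congrArg Prod.fst h)

/-- The edges that join each `i < k` to the vertex `k + f i`. They form a forest of stars, whose
leaves are the vertices below `k`. -/
def forest {k r : ℕ} (f : Fin k → Fin r) : Finset (Fin (k + r) × Fin (k + r)) :=
  Finset.univ.map (forestEdge f)

theorem mem_forest {k r : ℕ} (f : Fin k → Fin r) (e : Fin (k + r) × Fin (k + r)) :
    e ∈ forest f ↔ ∃ i, (Fin.castAdd r i, Fin.natAdd k (f i)) = e := by
  simp only [forest, Finset.mem_map, Finset.mem_univ, true_and]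
  rfl

theorem castAdd_lt_natAdd {k r : ℕ} (i : Fin k) (j : Fin r) :
    Fin.castAdd r i < Fin.natAdd k j := by
  rw [Fin.lt_def, Fin.val_castAdd, Fin.val_natAdd]
  omega

theorem lt_of_mem_forest {k r : ℕ} (f : Fin k → Fin r) : ∀ e ∈ forest f, e.1 < e.2 := by
  intro e he
  obtain ⟨i, rfl⟩ := (mem_forest f e).mp he
  exact castAdd_lt_natAdd _ _

theorem natAdd_ne_castAdd {k r : ℕ} (i : Fin k) (j : Fin r) :
    Fin.natAdd k j ≠ Fin.castAdd r i :=
  (castAdd_lt_natAdd i j).ne'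

theorem exponent_forest {k r : ℕ} (f : Fin k → Fin r) (lam : ℝ) (x : Config (k + r)) :
    exponent (ofPairs (forest f)) lam x =
      lam * ∑ i, spin x (Fin.castAdd r i) * spin x (Fin.natAdd k (f i)) := by
  rw [exponent_eq_sum_pairs, pairs_ofPairs (lt_of_mem_forest f), forest, Finset.sum_map]
  rfl

/-- The factor of the edge at the leaf `i` averages to `cosh lam`. -/
theorem sum_exp_forest {k r : ℕ} (f : Fin k → Fin r) (lam : ℝ) (D : Finset (Fin k)) :
    ∑ x : Config (k + r),
      Real.exp (lam * ∑ i ∈ D, spin x (Fin.castAdd r i) * spin x (Fin.natAdd k (f i))) =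
      2 ^ (k + r) * Real.cosh lam ^ D.card := by
  classical
  induction D using Finset.induction_on with
  | empty => simp
  | insert i D hi ih =>
    rw [Finset.card_insert_of_notMem hi, pow_succ, ← mul_assoc, ← ih, Finset.sum_mul, ← sub_eq_zero,
      ← Finset.sum_sub_distrib]
    refine sum_eq_zero_of_flip (Fin.castAdd r i) fun x => ?_
    have hD : ∑ j ∈ D, spin (flip (Fin.castAdd r i) x) (Fin.castAdd r j) *
          spin (flip (Fin.castAdd r i) x) (Fin.natAdd k (f j)) =
        ∑ j ∈ D, spin x (Fin.castAdd r j) * spin x (Fin.natAdd k (f j)) := by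
      refine Finset.sum_congr rfl fun j hj => ?_
      rw [spin_flip_of_ne (natAdd_ne_castAdd i (f j)), spin_flip_of_ne]
      intro h
      exact hi (Fin.castAdd_injective k r h ▸ hj)
    rw [Finset.sum_insert hi, Finset.sum_insert hi, hD, spin_flip_self,
      spin_flip_of_ne (natAdd_ne_castAdd i (f i)), mul_add, Real.exp_add, mul_add, Real.exp_add]
    have hc : Real.exp lam + Real.exp (-lam) = 2 * Real.cosh lam := by
      rw [Real.cosh_eq]; ring
    rcases spin_eq_or x (Fin.castAdd r i) with h1 | h1 <;>
      rcases spin_eq_or x (Fin.natAdd k (f i)) with h2 | h2 <;>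
      simp only [h1, h2, mul_one, mul_neg, neg_neg] <;>
      linear_combination (Real.exp (lam * ∑ j ∈ D,
        spin x (Fin.castAdd r j) * spin x (Fin.natAdd k (f j)))) * hc

theorem sum_spin_mul_spin_exp_forest {k r : ℕ} (f : Fin k → Fin r) (lam : ℝ) (i : Fin k) :
    ∑ x : Config (k + r), spin x (Fin.castAdd r i) * spin x (Fin.natAdd k (f i)) *
      Real.exp (lam * ∑ j, spin x (Fin.castAdd r j) * spin x (Fin.natAdd k (f j))) =
      Real.tanh lam * ∑ x : Config (k + r),
        Real.exp (lam * ∑ j, spin x (Fin.castAdd r j) * spin x (Fin.natAdd k (f j))) := by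
  classical
  set i' := Fin.castAdd r i
  set u := Fin.natAdd k (f i)
  have hu : u ≠ i' := natAdd_ne_castAdd i (f i)
  set R : Config (k + r) → ℝ := fun x => ∑ j ∈ Finset.univ.erase i,
    spin x (Fin.castAdd r j) * spin x (Fin.natAdd k (f j)) with hR
  have hRflip : ∀ x, R (flip i' x) = R x := by
    intro x
    refine Finset.sum_congr rfl fun j hj => ?_
    rw [spin_flip_of_ne (natAdd_ne_castAdd i (f j)), spin_flip_of_ne]
    intro h
    exact Finset.ne_of_mem_erase hj (Fin.castAdd_injective k r h)
  have hexp : ∀ x : Config (k + r),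
      Real.exp (lam * ∑ j, spin x (Fin.castAdd r j) * spin x (Fin.natAdd k (f j))) =
        Real.exp (spin x i' * (lam * spin x u)) * Real.exp (lam * R x) := by
    intro x
    rw [← Finset.add_sum_erase _ _ (Finset.mem_univ i), ← Real.exp_add]
    congr 1
    ring
  simp only [hexp]
  have h := sum_spin_mul_exp i' (h := fun x => lam * spin x u)
    (w := fun x => spin x u * Real.exp (lam * R x))
    (fun x => by rw [spin_flip_of_ne hu]) (fun x => by rw [spin_flip_of_ne hu, hRflip])
  rw [Finset.mul_sum]
  calc _ = _ := Finset.sum_congr rfl fun x _ => by ring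
    _ = _ := h
    _ = _ := Finset.sum_congr rfl fun x _ => by
      rcases spin_eq_or x u with h1 | h1 <;> simp [h1]

theorem relEntropy_forest {k r : ℕ} (f : Fin k → Fin r) (lam : ℝ) :
    relEntropy (ofPairs (forest f)) ⊥ lam =
      k * (lam * Real.tanh lam - Real.log (Real.cosh lam)) := by
  have hbot : ∀ x : Config (k + r), exponent ⊥ lam x = 0 := fun x => by
    simp [exponent, coupling]
  have hZ : partitionFunction (ofPairs (forest f)) lam =
      2 ^ (k + r) * Real.cosh lam ^ k := by
    simp only [partitionFunction, exponent_forest]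
    simpa using sum_exp_forest f lam Finset.univ
  have hZbot : partitionFunction (⊥ : SimpleGraph (Fin (k + r))) lam = 2 ^ (k + r) := by
    simp [partitionFunction, hbot]
  have hmean : ∑ x, isingProb (ofPairs (forest f)) lam x * exponent (ofPairs (forest f)) lam x =
      k * (lam * Real.tanh lam) := by
    have hZ0 := partitionFunction_pos (ofPairs (forest f)) lam
    have h1 : ∀ i, ∑ x : Config (k + r), isingProb (ofPairs (forest f)) lam x *
        (spin x (Fin.castAdd r i) * spin x (Fin.natAdd k (f i))) = Real.tanh lam := by
      intro i
      have h := sum_spin_mul_spin_exp_forest f lam i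
      simp only [← exponent_forest] at h
      rw [← partitionFunction.eq_1, ← div_eq_iff hZ0.ne', Finset.sum_div] at h
      rw [← h]
      refine Finset.sum_congr rfl fun x _ => ?_
      rw [isingProb]
      ring
    simp only [exponent_forest, mul_left_comm _ lam, ← Finset.mul_sum]
    simp only [Finset.mul_sum]
    rw [Finset.sum_comm]
    simp only [← Finset.mul_sum, h1]
    simp
  rw [relEntropy_eq]
  simp only [hbot, sub_zero]
  rw [hmean, hZ, hZbot, mul_div_cancel_left₀ _ (by positivity), Real.log_pow]
  ring

/-- The difference of the two sides vanishes at `0` and has the nonnegative derivative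
`(sinh t * cosh t - t) / (2 * cosh t ^ 2)`. -/
theorem half_mul_tanh_le_log_cosh {t : ℝ} (ht : 0 ≤ t) :
    t * Real.tanh t / 2 ≤ Real.log (Real.cosh t) := by
  have hd : ∀ s : ℝ, HasDerivAt
      (fun s => Real.log (Real.cosh s) - s * (Real.sinh s / Real.cosh s) / 2)
      ((Real.sinh s * Real.cosh s - s) / (2 * Real.cosh s ^ 2)) s := by
    intro s
    have hc := Real.cosh_pos s
    have h1 := (Real.hasDerivAt_cosh s).log hc.ne'
    have h2 := (Real.hasDerivAt_sinh s).div (Real.hasDerivAt_cosh s) hc.ne'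
    refine (h1.sub (((hasDerivAt_id s).mul h2).div_const 2)).congr_deriv ?_
    simp only [Pi.div_apply, id]
    field_simp
    linear_combination (-s) * Real.cosh_sq s
  have hmono := monotoneOn_of_deriv_nonneg (convex_Ici (0 : ℝ))
    (fun s _ => (hd s).continuousAt.continuousWithinAt)
    (fun s _ => (hd s).differentiableAt.differentiableWithinAt)
    (fun s hs => by
      rw [(hd s).deriv]
      rw [interior_Ici] at hs
      have hs' : 0 ≤ s := (Set.mem_Ioi.mp hs).le
      have h1 := Real.self_le_sinh_iff.mpr hs'
      have h2 := Real.one_le_cosh s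
      exact div_nonneg (by nlinarith) (by positivity))
  have h := hmono (Set.mem_Ici.mpr le_rfl) (Set.mem_Ici.mpr ht) ht
  simp only [Real.cosh_zero, Real.log_one, zero_mul, zero_div, sub_zero] at h
  rw [Real.tanh_eq_sinh_div_cosh]
  linarith

theorem relEntropy_forest_le {k r : ℕ} (f : Fin k → Fin r) {lam : ℝ} (hlam : 0 ≤ lam) :
    relEntropy (ofPairs (forest f)) ⊥ lam ≤ k * (lam * Real.tanh lam / 2) := by
  rw [relEntropy_forest]
  refine mul_le_mul_of_nonneg_left ?_ (Nat.cast_nonneg k)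
  linarith [half_mul_tanh_le_log_cosh hlam]

theorem card_symmDiff_forest {k r : ℕ} (f g : Fin k → Fin r) :
    (symmDiff (forest f) (forest g)).card = 2 * hammingDist f g := by
  have hsd : ∀ f g : Fin k → Fin r, (forest f \ forest g).card = hammingDist f g := by
    intro f g
    have : forest f \ forest g =
        (Finset.univ.filter fun i => f i ≠ g i).map (forestEdge f) := by
      ext e
      simp only [Finset.mem_sdiff, mem_forest, Finset.mem_map, Finset.mem_filter, Finset.mem_univ,
        true_and]
      constructor
      · rintro ⟨⟨i, rfl⟩, h⟩
        exact ⟨i, fun h' => h ⟨i, by rw [h']⟩, rfl⟩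
      · rintro ⟨i, h, rfl⟩
        refine ⟨⟨i, rfl⟩, ?_⟩
        rintro ⟨j, hj⟩
        obtain rfl := Fin.castAdd_injective k r (congrArg Prod.fst hj)
        exact h (Fin.natAdd_injective r k (congrArg Prod.snd hj)).symm
    rw [this, Finset.card_map, hammingDist]
  rw [symmDiff_def, Finset.sup_eq_union, Finset.card_union_of_disjoint disjoint_sdiff_sdiff, hsd,
    hsd, hammingDist_comm g f, two_mul]

/-- A function within Hamming distance `q` of `f` is determined by the set where it differs from `f`
and its at most `q` values there. -/
theorem card_hammingBall_le {k r : ℕ} (hr : 0 < r) (f : Fin k → Fin r) (q : ℕ) :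
    (Finset.univ.filter fun g : Fin k → Fin r => hammingDist g f ≤ q).card ≤ 2 ^ k * r ^ q := by
  classical
  have hsub : (Finset.univ.filter fun g : Fin k → Fin r => hammingDist g f ≤ q) ⊆
      ((Finset.univ : Finset (Finset (Fin k))).filter fun D => D.card ≤ q).biUnion fun D =>
        Fintype.piFinset fun i => if i ∈ D then Finset.univ else {f i} := by
    intro g hg
    rw [Finset.mem_filter] at hg
    rw [Finset.mem_biUnion]
    refine ⟨Finset.univ.filter fun i => g i ≠ f i, by simpa [hammingDist] using hg.2, ?_⟩
    rw [Fintype.mem_piFinset]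
    intro i
    by_cases h : g i = f i <;> simp [h]
  calc _ ≤ _ := Finset.card_le_card hsub
    _ ≤ ∑ D ∈ (Finset.univ : Finset (Finset (Fin k))).filter fun D => D.card ≤ q, r ^ q := by
      refine Finset.card_biUnion_le.trans (Finset.sum_le_sum fun D hD => ?_)
      rw [Fintype.card_piFinset]
      have : ∀ i, (if i ∈ D then (Finset.univ : Finset (Fin r)) else {f i}).card =
          if i ∈ D then r else 1 := fun i => by split_ifs <;> simp
      simp only [this, Finset.prod_ite_mem, Finset.univ_inter, Finset.prod_const]
      exact Nat.pow_le_pow_right hr (Finset.mem_filter.mp hD).2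
    _ ≤ 2 ^ k * r ^ q := by
      rw [Finset.sum_const, smul_eq_mul]
      refine Nat.mul_le_mul_right _ ((Finset.card_filter_le _ _).trans ?_)
      simp

open Classical in
/-- A ball of radius `q` about any graph `H` lies in a ball of radius `2 * q` about each forest it
contains, and two forests are at twice the Hamming distance of their functions. -/
theorem card_forest_ball_le {k r : ℕ} (hr : 0 < r) (H : SimpleGraph (Fin (k + r))) (q : ℕ) :
    (Finset.univ.filter fun f : Fin k → Fin r =>
      editDist (ofPairs (forest f)) H ≤ q).card ≤ 2 ^ k * r ^ q := by
  rcases Finset.eq_empty_or_nonempty (Finset.univ.filter fun f : Fin k → Fin r =>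
      editDist (ofPairs (forest f)) H ≤ q) with h | ⟨g, hg⟩
  · simp [h]
  · refine (Finset.card_le_card fun f hf => ?_).trans (card_hammingBall_le hr g q)
    simp only [Finset.mem_filter, Finset.mem_univ, true_and, editDist_eq_card,
      pairs_ofPairs (lt_of_mem_forest _)] at hf hg ⊢
    have h1 : (symmDiff (forest f) (forest g)).card ≤
        (symmDiff (forest f) (pairs H)).card + (symmDiff (forest g) (pairs H)).card := by
      rw [symmDiff_comm (forest g)]
      exact (Finset.card_le_card (symmDiff_triangle _ _ _)).trans (Finset.card_union_le _ _)
    rw [card_symmDiff_forest] at h1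
    omega

theorem ofPairs_forest_mem_edgeBoundedClass {k r : ℕ} (f : Fin k → Fin r) :
    ofPairs (forest f) ∈ edgeBoundedClass (k + r) k := by
  rw [edgeBoundedClass, Set.mem_ofPred_eq, ncard_edgeSet_eq_card,
    pairs_ofPairs (lt_of_mem_forest f), forest, Finset.card_map, Finset.card_univ, Fintype.card_fin]

/-! ### Complete bipartite graphs at low temperature -/

/-- The total spin of the vertices in `A`. -/
def totalSpin {p : ℕ} (A : Finset (Fin p)) (x : Config p) : ℝ := ∑ i ∈ A, spin x i

theorem totalSpin_flip_of_notMem {p : ℕ} {A : Finset (Fin p)} {i : Fin p} (hi : i ∉ A)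
    (x : Config p) : totalSpin A (flip i x) = totalSpin A x :=
  Finset.sum_congr rfl fun _ hj => spin_flip_of_ne (ne_of_mem_of_not_mem hj hi) x

theorem abs_totalSpin_le {p : ℕ} (A : Finset (Fin p)) (x : Config p) :
    |totalSpin A x| ≤ A.card := by
  refine (Finset.abs_sum_le_sum_abs _ _).trans (le_of_eq ?_)
  rw [Finset.sum_congr rfl (g := fun _ => (1 : ℝ)), Finset.sum_const, nsmul_eq_mul, mul_one]
  intro i _
  rcases spin_eq_or x i with h | h <;> simp [h]

theorem lt_of_mem_product {p : ℕ} {A L : Finset (Fin p)} (h : ∀ a ∈ A, ∀ l ∈ L, a < l) :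
    ∀ e ∈ A ×ˢ L, e.1 < e.2 := fun _ he =>
  h _ (Finset.mem_product.mp he).1 _ (Finset.mem_product.mp he).2

theorem exponent_product {p : ℕ} {A L : Finset (Fin p)} (h : ∀ a ∈ A, ∀ l ∈ L, a < l) (lam : ℝ)
    (x : Config p) : exponent (ofPairs (A ×ˢ L)) lam x = lam * (totalSpin A x * totalSpin L x) := by
  rw [exponent_eq_sum_pairs, pairs_ofPairs (lt_of_mem_product h), totalSpin, totalSpin,
    Finset.sum_mul_sum, Finset.sum_product]

theorem sum_spin_mul_exp_product {p : ℕ} {A L : Finset (Fin p)} {u : Fin p} (hA : u ∉ A)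
    (hL : u ∈ L) (lam : ℝ) {g : Config p → ℝ} (hg : ∀ x, g (flip u x) = g x) :
    ∑ x, spin x u * (g x * Real.exp (lam * (totalSpin A x * totalSpin L x))) =
      ∑ x, Real.tanh (lam * totalSpin A x) *
        (g x * Real.exp (lam * (totalSpin A x * totalSpin L x))) := by
  have hexp : ∀ x : Config p, g x * Real.exp (lam * (totalSpin A x * totalSpin L x)) =
      Real.exp (spin x u * (lam * totalSpin A x)) *
        (g x * Real.exp (lam * (totalSpin A x * totalSpin (L.erase u) x))) := by
    intro x
    rw [mul_left_comm (Real.exp _), ← Real.exp_add, totalSpin.eq_1 L,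
      ← Finset.add_sum_erase _ _ hL, totalSpin, totalSpin]
    congr 2
    ring
  simp only [hexp]
  refine sum_spin_mul_exp u (fun x => ?_) fun x => ?_
  · rw [totalSpin_flip_of_notMem hA]
  · rw [hg, totalSpin_flip_of_notMem hA, totalSpin_flip_of_notMem (Finset.notMem_erase u L)]

/-- Given the spins in `A`, those in `L` are independent with mean `tanh (lam * totalSpin A)`. -/
theorem sum_one_sub_spin_mul_spin {p : ℕ} {A L : Finset (Fin p)} {u v : Fin p} (huA : u ∉ A)
    (huL : u ∈ L) (hvA : v ∉ A) (hvL : v ∈ L) (huv : u ≠ v) (lam : ℝ) :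
    ∑ x, (1 - spin x u * spin x v) * Real.exp (lam * (totalSpin A x * totalSpin L x)) =
      ∑ x, (Real.cosh (lam * totalSpin A x) ^ 2)⁻¹ *
        Real.exp (lam * (totalSpin A x * totalSpin L x)) := by
  have h1 := sum_spin_mul_exp_product huA huL lam (g := fun x => spin x v)
    fun x => spin_flip_of_ne huv.symm x
  have h2 := sum_spin_mul_exp_product hvA hvL lam
    (g := fun x => Real.tanh (lam * totalSpin A x))
    fun x => by rw [totalSpin_flip_of_notMem hvA]
  have h3 : ∀ t : ℝ, (Real.cosh t ^ 2)⁻¹ = 1 - Real.tanh t * Real.tanh t := by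
    intro t
    have := Real.cosh_pos t
    rw [Real.tanh_eq_sinh_div_cosh]
    field_simp
    linarith [Real.cosh_sq t]
  simp only [h3, sub_mul, one_mul, Finset.sum_sub_distrib, mul_assoc]
  rw [h1, ← h2]
  congr 1
  exact Finset.sum_congr rfl fun x _ => by ring

theorem exp_abs_le_two_mul_cosh (t : ℝ) : Real.exp |t| ≤ 2 * Real.cosh t := by
  rw [← Real.cosh_abs, Real.cosh_eq]
  linarith [Real.exp_pos (-|t|)]

/-- Strong alignment in `A` makes `cosh` large, while the configurations without it have a small
weight. The threshold `exp (lam * |A|) / 8` separates the two cases. -/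
theorem inv_cosh_sq_mul_exp_le {p : ℕ} {A L : Finset (Fin p)} (hL : 2 ≤ L.card) (lam : ℝ)
    (x : Config p) :
    (Real.cosh (lam * totalSpin A x) ^ 2)⁻¹ *
        Real.exp (lam * (totalSpin A x * totalSpin L x)) ≤
      64 * Real.exp (-(2 * lam * A.card)) * Real.exp (lam * (totalSpin A x * totalSpin L x)) +
        4 * (Real.exp (lam * A.card) / 4) ^ (L.card - 2) := by
  set h := lam * totalSpin A x
  set E := Real.exp (lam * A.card)
  have hE : 0 < E := Real.exp_pos _
  have hc := Real.cosh_pos h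
  have hEE : Real.exp (-(2 * lam * A.card)) = (E ^ 2)⁻¹ := by
    rw [← Real.exp_nat_mul, ← Real.exp_neg]
    congr 1
    push_cast
    ring
  rw [hEE]
  rcases le_total (E / 8) (Real.cosh h) with hle | hle
  · have h1 : (Real.cosh h ^ 2)⁻¹ ≤ 64 * (E ^ 2)⁻¹ := by
      have : 64 * (E ^ 2)⁻¹ = ((E / 8) ^ 2)⁻¹ := by field_simp; norm_num
      rw [this]
      gcongr
    have h2 := mul_le_mul_of_nonneg_right h1
      (Real.exp_pos (lam * (totalSpin A x * totalSpin L x))).le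
    have h3 : 0 ≤ 4 * (E / 4) ^ (L.card - 2) := by positivity
    linarith
  · have h1 : Real.exp (lam * (totalSpin A x * totalSpin L x)) ≤ (2 * Real.cosh h) ^ L.card := by
      refine le_trans ?_ (pow_le_pow_left₀ (Real.exp_pos _).le (exp_abs_le_two_mul_cosh h) _)
      rw [← Real.exp_nat_mul]
      refine Real.exp_le_exp.mpr ?_
      calc lam * (totalSpin A x * totalSpin L x) = h * totalSpin L x := by ring
        _ ≤ |h| * |totalSpin L x| := by rw [← abs_mul]; exact le_abs_self _
        _ ≤ |h| * L.card := mul_le_mul_of_nonneg_left (abs_totalSpin_le L x) (abs_nonneg h)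
        _ = L.card * |h| := mul_comm _ _
    have h2 : (2 * Real.cosh h) ^ L.card =
        Real.cosh h ^ 2 * (4 * (2 * Real.cosh h) ^ (L.card - 2)) := by
      obtain ⟨m, hm⟩ := Nat.exists_eq_add_of_le hL
      rw [hm, Nat.add_sub_cancel_left, pow_add]
      ring
    have h3 : (2 * Real.cosh h) ^ (L.card - 2) ≤ (E / 4) ^ (L.card - 2) :=
      pow_le_pow_left₀ (by positivity) (by linarith) _
    have h4 : 0 ≤ 64 * (E ^ 2)⁻¹ * Real.exp (lam * (totalSpin A x * totalSpin L x)) := by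
      positivity
    calc _ ≤ (Real.cosh h ^ 2)⁻¹ * (Real.cosh h ^ 2 * (4 * (2 * Real.cosh h) ^ (L.card - 2))) := by
          rw [← h2]; gcongr
      _ = 4 * (2 * Real.cosh h) ^ (L.card - 2) := by
          rw [inv_mul_cancel_left₀ (by positivity)]
      _ ≤ _ := by linarith

/-- The configurations equal to `1` on `A ∪ L` bound the partition function from below. -/
theorem two_pow_mul_exp_le {p : ℕ} (A L : Finset (Fin p)) (lam : ℝ) :
    (2 : ℝ) ^ p * Real.exp (lam * (A.card * L.card)) ≤ 2 ^ (A.card + L.card) *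
      ∑ x : Config p, Real.exp (lam * (totalSpin A x * totalSpin L x)) := by
  classical
  set F : Finset (Config p) := Fintype.piFinset fun i => if i ∈ A ∪ L then {1} else Finset.univ
  have hF : 2 ^ p ≤ 2 ^ (A.card + L.card) * F.card := by
    have h1 : ∀ i, (if i ∈ A ∪ L then ({1} : Finset ℤˣ) else Finset.univ).card =
        if i ∈ (A ∪ L)ᶜ then 2 else 1 := fun i => by
      by_cases h : i ∈ A ∪ L <;> simp only [h, Finset.mem_compl] <;> simp
    have h2 : F.card = 2 ^ (p - (A ∪ L).card) := by
      rw [Fintype.card_piFinset]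
      simp only [h1, Finset.prod_ite_mem, Finset.univ_inter, Finset.prod_const, Finset.card_compl,
        Fintype.card_fin]
    rw [h2, ← pow_add]
    have := Finset.card_union_le A L
    exact Nat.pow_le_pow_right two_pos (by omega)
  have hspin : ∀ x ∈ F, ∀ i ∈ A ∪ L, spin x i = 1 := by
    intro x hx i hi
    have h := Fintype.mem_piFinset.mp hx i
    rw [if_pos hi, Finset.mem_singleton] at h
    simp [spin, h]
  have hsum : F.card * Real.exp (lam * (A.card * L.card)) ≤
      ∑ x : Config p, Real.exp (lam * (totalSpin A x * totalSpin L x)) := by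
    rw [← nsmul_eq_mul, ← Finset.sum_const]
    refine le_trans (Finset.sum_le_sum fun x hx => le_of_eq ?_)
      (Finset.sum_le_sum_of_subset_of_nonneg (Finset.subset_univ F)
        fun x _ _ => (Real.exp_pos _).le)
    rw [totalSpin, totalSpin, Finset.sum_congr rfl fun i hi =>
      hspin x hx i (Finset.mem_union_left L hi), Finset.sum_congr rfl fun i hi =>
      hspin x hx i (Finset.mem_union_right A hi)]
    simp
  have hF' : (2 : ℝ) ^ p ≤ 2 ^ (A.card + L.card) * F.card := by exact_mod_cast hF
  calc _ ≤ 2 ^ (A.card + L.card) * F.card * Real.exp (lam * (A.card * L.card)) := by gcongr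
    _ ≤ _ := by rw [mul_assoc]; gcongr

/-- Two vertices on the same side of a complete bipartite graph disagree with probability
exponentially small in the size of the other side. -/
theorem mean_one_sub_spin_mul_spin_le {p : ℕ} {A L : Finset (Fin p)}
    (hAL : ∀ a ∈ A, ∀ l ∈ L, a < l) (hcard : A.card ≤ L.card) {u v : Fin p}
    (hu : u ∈ L) (hv : v ∈ L) (huv : u ≠ v) (lam : ℝ) :
    ∑ x, isingProb (ofPairs (A ×ˢ L)) lam x * (1 - spin x u * spin x v) ≤
      128 * Real.exp (-(2 * lam * A.card)) := by
  have hnot : ∀ w ∈ L, w ∉ A := fun w hw hwA => lt_irrefl _ (hAL w hwA w hw)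
  have hL : 2 ≤ L.card := Finset.one_lt_card.mpr ⟨u, hu, v, hv, huv⟩
  set Z := ∑ x : Config p, Real.exp (lam * (totalSpin A x * totalSpin L x)) with hZ
  have hZeq : partitionFunction (ofPairs (A ×ˢ L)) lam = Z := by
    simp only [partitionFunction, exponent_product hAL, hZ]
  have hZpos : 0 < Z := hZeq ▸ partitionFunction_pos _ _
  have hmain : ∑ x, (1 - spin x u * spin x v) *
      Real.exp (lam * (totalSpin A x * totalSpin L x)) ≤
      128 * Real.exp (-(2 * lam * A.card)) * Z := by
    rw [sum_one_sub_spin_mul_spin (hnot u hu) hu (hnot v hv) hv huv]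
    refine (Finset.sum_le_sum fun x _ => inv_cosh_sq_mul_exp_le hL lam x).trans ?_
    rw [Finset.sum_add_distrib, ← Finset.mul_sum, ← hZ, Finset.sum_const, Finset.card_univ,
      nsmul_eq_mul]
    have hcardC : ((Fintype.card (Config p) : ℕ) : ℝ) = 2 ^ p := by simp
    rw [hcardC]
    have hlow := two_pow_mul_exp_le A L lam
    rw [← hZ] at hlow
    obtain ⟨m, hm⟩ := Nat.exists_eq_add_of_le hL
    have hexp : Real.exp (lam * (A.card * L.card)) =
        Real.exp (lam * A.card) ^ m * Real.exp (2 * lam * A.card) := by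
      rw [← Real.exp_nat_mul, ← Real.exp_add, hm]
      congr 1
      push_cast
      ring
    have h2 : (2 : ℝ) ^ (A.card + L.card) ≤ 16 * 4 ^ m := by
      calc (2 : ℝ) ^ (A.card + L.card) ≤ 2 ^ (L.card + L.card) := by
            gcongr
            · norm_num
        _ = 16 * 4 ^ m := by
            rw [hm, ← two_mul, pow_mul, pow_add]
            norm_num
    rw [hexp] at hlow
    have h3 : (2 : ℝ) ^ p * (4 * (Real.exp (lam * A.card) / 4) ^ (L.card - 2)) ≤
        64 * Real.exp (-(2 * lam * A.card)) * Z := by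
      rw [hm, Nat.add_sub_cancel_left, div_pow, Real.exp_neg]
      have h4 := hlow.trans (mul_le_mul_of_nonneg_right h2 hZpos.le)
      have he := Real.exp_pos (2 * lam * A.card)
      rw [← sub_nonneg] at h4 ⊢
      have h5 : (64 * (Real.exp (2 * lam * A.card))⁻¹ * Z -
          2 ^ p * (4 * (Real.exp (lam * A.card) ^ m / 4 ^ m))) =
          (4 / (4 ^ m * Real.exp (2 * lam * A.card))) * (16 * 4 ^ m * Z -
            2 ^ p * (Real.exp (lam * A.card) ^ m * Real.exp (2 * lam * A.card))) := by
        field_simp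
        ring
      rw [h5]
      positivity
    linarith
  have hconv : ∑ x, isingProb (ofPairs (A ×ˢ L)) lam x * (1 - spin x u * spin x v) =
      (∑ x, (1 - spin x u * spin x v) *
        Real.exp (lam * (totalSpin A x * totalSpin L x))) / Z := by
    rw [Finset.sum_div]
    refine Finset.sum_congr rfl fun x _ => ?_
    rw [isingProb, exponent_product hAL, hZeq]
    ring
  rw [hconv, div_le_iff₀ hZpos]
  exact hmain

/-- Adding edges between vertices that already agree with high probability has little effect on
the model. -/
theorem relEntropy_le_of_pairs_eq_union {p : ℕ} {G Q : SimpleGraph (Fin p)}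
    {S : Finset (Fin p × Fin p)} (hG : pairs G = pairs Q ∪ S) (hS : Disjoint (pairs Q) S)
    {lam ε : ℝ} (hlam : 0 ≤ lam)
    (hε : ∀ e ∈ S, ∑ x, isingProb Q lam x * (1 - spin x e.1 * spin x e.2) ≤ ε) :
    relEntropy G Q lam ≤ lam * (S.card * ε) := by
  set φ : Config p → ℝ := fun x => lam * ∑ e ∈ S, spin x e.1 * spin x e.2 with hφ
  have hexp : ∀ x, exponent G lam x = exponent Q lam x + φ x := by
    intro x
    rw [exponent_eq_sum_pairs, exponent_eq_sum_pairs, hG, Finset.sum_union hS, mul_add]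
  have hφle : ∀ x, φ x ≤ lam * S.card := by
    intro x
    refine mul_le_mul_of_nonneg_left ?_ hlam
    rw [← nsmul_one S.card]
    refine Finset.sum_le_card_nsmul _ _ _ fun e _ => ?_
    rcases spin_eq_or x e.1 with h1 | h1 <;> rcases spin_eq_or x e.2 with h2 | h2 <;>
      norm_num [h1, h2]
  have hmean : lam * (S.card - S.card * ε) ≤ ∑ x, isingProb Q lam x * φ x := by
    have h1 : ∀ e ∈ S, 1 - ε ≤ ∑ x, isingProb Q lam x * (spin x e.1 * spin x e.2) := by
      intro e he
      have h := hε e he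
      simp only [mul_sub, mul_one, Finset.sum_sub_distrib, sum_isingProb] at h
      linarith
    have h2 := Finset.card_nsmul_le_sum S _ _ h1
    have h3 : ∑ x, isingProb Q lam x * φ x =
        lam * ∑ e ∈ S, ∑ x, isingProb Q lam x * (spin x e.1 * spin x e.2) := by
      rw [Finset.sum_comm, Finset.mul_sum]
      refine Finset.sum_congr rfl fun x _ => ?_
      rw [hφ, ← Finset.mul_sum]
      ring
    rw [h3]
    refine mul_le_mul_of_nonneg_left ?_ hlam
    rw [nsmul_eq_mul] at h2
    linarith
  have hZ : partitionFunction G lam / partitionFunction Q lam =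
      ∑ x, isingProb Q lam x * Real.exp (φ x) := by
    rw [partitionFunction.eq_1 G, Finset.sum_div]
    refine Finset.sum_congr rfl fun x _ => ?_
    rw [hexp, Real.exp_add, isingProb]
    ring
  have hjensen : Real.exp (∑ x, isingProb Q lam x * φ x) ≤
      ∑ x, isingProb Q lam x * Real.exp (φ x) := by
    simpa only [smul_eq_mul] using convexOn_exp.map_sum_le (t := Finset.univ)
      (w := isingProb Q lam) (p := φ) (fun x _ => (isingProb_pos Q lam x).le)
      (sum_isingProb Q lam) (fun x _ => Set.mem_univ _)
  have hlog := (Real.le_log_iff_exp_le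
    (div_pos (partitionFunction_pos G lam) (partitionFunction_pos Q lam))).mpr (hZ ▸ hjensen)
  have hGmean : ∑ x, isingProb G lam x * (exponent G lam x - exponent Q lam x) ≤
      lam * S.card := by
    calc _ ≤ ∑ x, isingProb G lam x * (lam * S.card) := by
          refine Finset.sum_le_sum fun x _ => ?_
          rw [hexp, add_sub_cancel_left]
          exact mul_le_mul_of_nonneg_left (hφle x) (isingProb_pos G lam x).le
      _ = lam * S.card := by rw [← Finset.sum_mul, sum_isingProb, one_mul]
  rw [relEntropy_eq]
  linarith

/-! ### Hamming balls in the cube of edge sets -/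

theorem card_filter_card_le_mul_pow {α : Type*} (N : Finset α) (q : ℕ) {t : ℝ}
    (h0 : 0 ≤ t) (h1 : t ≤ 1) :
    (N.powerset.filter fun W => W.card ≤ q).card * t ^ q ≤ (1 + t) ^ N.card := by
  have h := Finset.sum_pow_mul_eq_add_pow t 1 N
  simp only [one_pow, mul_one] at h
  rw [add_comm, ← h, ← nsmul_eq_mul]
  calc _ ≤ ∑ W ∈ N.powerset.filter fun W => W.card ≤ q, t ^ W.card :=
        Finset.card_nsmul_le_sum _ _ _ fun W hW =>
          pow_le_pow_of_le_one h0 h1 (Finset.mem_filter.mp hW).2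
    _ ≤ _ := Finset.sum_le_sum_of_subset_of_nonneg (Finset.filter_subset _ _)
        fun W _ _ => pow_nonneg h0 _

/-- The entropy bound for the size of a Hamming ball. -/
theorem card_filter_card_le_exp {α : Type*} (N : Finset α) {q : ℕ} {s : ℝ} (hs0 : 0 < s)
    (hs : s ≤ 1 / 2) (hq : (q : ℝ) ≤ s * N.card) :
    ((N.powerset.filter fun W => W.card ≤ q).card : ℝ) ≤
      Real.exp (N.card * Real.binEntropy s) := by
  have hs1 : 0 < 1 - s := by linarith
  -- The best choice of the parameter is the odds ratio of `s`.
  set t := s / (1 - s) with ht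
  have ht0 : 0 < t := div_pos hs0 hs1
  have ht1 : t ≤ 1 := (div_le_one hs1).mpr (by linarith)
  have h := card_filter_card_le_mul_pow N q ht0.le ht1
  have hlogt : Real.log t = Real.log s - Real.log (1 - s) := Real.log_div hs0.ne' hs1.ne'
  have hlogt0 : Real.log t ≤ 0 := Real.log_nonpos ht0.le ht1
  have h1t : 1 + t = (1 - s)⁻¹ := by rw [ht]; field_simp; ring
  have hlog1t : Real.log (1 + t) = -Real.log (1 - s) := by rw [h1t, Real.log_inv]
  rw [← le_div_iff₀ (by positivity)] at h
  refine h.trans ?_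
  rw [← Real.log_le_iff_le_exp (by positivity), Real.log_div (by positivity) (by positivity),
    Real.log_pow, Real.log_pow, hlog1t, Real.binEntropy, Real.log_inv, Real.log_inv]
  have h2 := mul_le_mul_of_nonpos_right hq hlogt0
  rw [hlogt] at h2 ⊢
  linarith

theorem card_symmDiff_ball_le {α : Type*} [DecidableEq α] (N U : Finset α) (q : ℕ) :
    (N.powerset.filter fun S => (symmDiff S (U ∩ N)).card ≤ q).card ≤
      (N.powerset.filter fun W => W.card ≤ q).card := by
  refine Finset.card_le_card_of_injOn (fun S => symmDiff S (U ∩ N)) ?_ ?_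
  · intro S hS
    simp only [Finset.coe_filter, Finset.mem_powerset, Set.mem_ofPred_eq] at hS ⊢
    refine ⟨fun a ha => ?_, hS.2⟩
    rcases Finset.mem_symmDiff.mp ha with h | h
    · exact hS.1 h.1
    · exact Finset.mem_of_mem_inter_right h.1
  · exact (symmDiff_left_injective (U ∩ N)).injOn

theorem maxErrorProb_edgeBoundedClass_nonneg {n p : ℕ} (k : ℕ) (lam : ℝ) (est : Estimator n p)
    (q : ℕ) : 0 ≤ maxErrorProb (edgeBoundedClass p k) lam est q :=
  (errorProb_nonneg lam est q ⊥).trans <| errorProb_le_maxErrorProb lam est q <| by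
    simp [edgeBoundedClass]

/-! ### The bound from star forests -/

/-- Fano's inequality for the `r ^ k` star forests with leaves `0, …, k - 1`, compared with the
empty graph. -/
theorem fano_forest {n k r : ℕ} {lam δ θ : ℝ} {est : Estimator n (k + r)} {q : ℕ}
    (hk : 0 < k) (hkr : k ≤ r) (hlam : 0 ≤ lam) (hq : (q : ℝ) ≤ θ * k)
    (herr : maxErrorProb (edgeBoundedClass (k + r) k) lam est q ≤ δ)
    (hlog : 2 * Real.log 2 ≤ (1 - θ) * Real.log ((k + r : ℕ) : ℝ)) :
    k * ((1 - θ) * Real.log ((k + r : ℕ) : ℝ) - 2 * Real.log 2) * (1 - δ) ≤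
      n * (k * (lam * Real.tanh lam / 2)) + Real.log 2 := by
  have hr : 0 < r := hk.trans_le hkr
  have hr' : (0 : ℝ) < r := by exact_mod_cast hr
  have : Nonempty (Fin r) := ⟨⟨0, hr⟩⟩
  refine fano (s := (Finset.univ : Finset (Fin k → Fin r))) (est := est) (q := q)
    Finset.univ_nonempty
    (fun f => ofPairs (forest f)) ⊥ (mul_nonneg (Nat.cast_nonneg k) (by linarith))
    (fun f _ => (errorProb_le_maxErrorProb lam est q
      (ofPairs_forest_mem_edgeBoundedClass f)).trans herr)
    (fun f _ => relEntropy_forest_le f hlam) fun H => ?_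
  have hball : (((Finset.univ : Finset (Fin k → Fin r)).filter fun f =>
      editDist (ofPairs (forest f)) H ≤ q).card : ℝ) ≤ 2 ^ k * (r : ℝ) ^ q := by
    exact_mod_cast card_forest_ball_le hr H q
  refine hball.trans ?_
  have hcard : (((Finset.univ : Finset (Fin k → Fin r)).card : ℕ) : ℝ) = (r : ℝ) ^ k := by
    simp
  rw [hcard, ← Real.log_le_log_iff (by positivity) (by positivity),
    Real.log_mul (by positivity) (by positivity), Real.log_mul (by positivity) (by positivity),
    Real.log_exp, Real.log_pow, Real.log_pow, Real.log_pow]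
  have hp : (0 : ℝ) < ((k + r : ℕ) : ℝ) := by positivity
  have hlogr : Real.log ((k + r : ℕ) : ℝ) ≤ Real.log 2 + Real.log r := by
    rw [← Real.log_mul two_ne_zero hr'.ne']
    refine Real.log_le_log hp ?_
    have : (k : ℝ) ≤ r := by exact_mod_cast hkr
    push_cast
    linarith
  have hlogr' : Real.log r ≤ Real.log ((k + r : ℕ) : ℝ) :=
    Real.log_le_log hr' (by push_cast; linarith [Nat.cast_nonneg (α := ℝ) k])
  have h0 : 0 ≤ Real.log (r : ℝ) := Real.log_natCast_nonneg r
  have h1 : (q : ℝ) * Real.log r ≤ θ * k * Real.log ((k + r : ℕ) : ℝ) :=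
    mul_le_mul hq hlogr' h0 ((Nat.cast_nonneg q).trans hq)
  have h2 := mul_le_mul_of_nonneg_left hlogr (Nat.cast_nonneg (α := ℝ) k)
  linarith

theorem tanh_pos {t : ℝ} (ht : 0 < t) : 0 < Real.tanh t := by
  rw [Real.tanh_eq_sinh_div_cosh]
  exact div_pos (Real.sinh_pos_iff.mpr ht) (Real.cosh_pos t)

theorem log_bound_le {n k p : ℕ} {lam δ θ : ℝ} {est : Estimator n p} (hθ : θ ∈ Set.Ioo 0 (1 / 4))
    (hk : 4 ≤ k) (hkp : 4 * k ≤ p) (hlam : 0 < lam)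
    (herr : maxErrorProb (edgeBoundedClass p k) lam est ⌊θ * (k : ℝ)⌋₊ ≤ δ) :
    2 * (1 - θ) * Real.log (p : ℝ) / (lam * Real.tanh lam) *
      (1 - δ - 4 * Real.log 2 / Real.log (4 * (k : ℝ))) ≤ n := by
  obtain ⟨r, rfl⟩ : ∃ r, p = k + r := ⟨p - k, by omega⟩
  have hk0 : (0 : ℝ) < k := by exact_mod_cast (by omega : 0 < k)
  have hδ : 0 ≤ δ := (maxErrorProb_edgeBoundedClass_nonneg k lam est _).trans herr
  have hl2 : 0 < Real.log 2 := Real.log_pos one_lt_two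
  set l := Real.log (4 * (k : ℝ)) with hl
  set L := Real.log ((k + r : ℕ) : ℝ) with hL
  have hlL : l ≤ L := Real.log_le_log (by positivity) (by exact_mod_cast hkp)
  have hl4 : 4 * Real.log 2 ≤ l := by
    rw [hl, show (4 : ℝ) * Real.log 2 = ((4 : ℕ) : ℝ) * Real.log 2 by norm_num, ← Real.log_pow]
    refine Real.log_le_log (by norm_num) ?_
    have : (4 : ℝ) ≤ k := by exact_mod_cast hk
    norm_num
    linarith
  have hlpos : 0 < l := by linarith
  have hθL : 3 / 4 * l ≤ (1 - θ) * L := by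
    have := hθ.2
    nlinarith
  have h := fano_forest (δ := δ) (est := est) (by omega) (by omega) hlam.le
    (Nat.floor_le (mul_nonneg hθ.1.le hk0.le)) herr (by linarith)
  rw [← hL] at h
  have hu : 0 < lam * Real.tanh lam := mul_pos hlam (tanh_pos hlam)
  set u := lam * Real.tanh lam
  have h1 : ((1 - θ) * L - 2 * Real.log 2) * (1 - δ) ≤ n * (u / 2) + Real.log 2 := by
    have hk1 : (1 : ℝ) ≤ k := by exact_mod_cast (by omega : 1 ≤ k)
    refine le_of_mul_le_mul_left ?_ hk0
    nlinarith
  have h2 : 3 * Real.log 2 ≤ (1 - θ) * L * (4 * Real.log 2 / l) := by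
    rw [mul_div_assoc', le_div_iff₀ hlpos]
    nlinarith
  rw [div_mul_eq_mul_div, div_le_iff₀ hu]
  nlinarith

/-! ### The bound from dense graphs -/

/-- Fano's inequality for the ensemble of graphs made of a complete bipartite graph between the
hubs `A` and the vertices `B ∪ C`, and of an arbitrary set of edges between `B` and `C`. -/
theorem fano_dense {n k p : ℕ} {lam δ s : ℝ} {est : Estimator n p} {q b : ℕ}
    {A B C : Finset (Fin p)} (hA : ∀ a ∈ A, ∀ l ∈ B ∪ C, a < l) (hBC : ∀ i ∈ B, ∀ j ∈ C, i < j)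
    (hB : B.card = b) (hC : C.card = b) (hAb : A.card ≤ 2 * b)
    (hk : A.card * (2 * b) + b * b ≤ k) (hlam : 0 ≤ lam) (hs0 : 0 < s) (hs : s ≤ 1 / 2)
    (hq : (q : ℝ) ≤ s * (b * b : ℕ))
    (herr : maxErrorProb (edgeBoundedClass p k) lam est q ≤ δ) :
    (b * b : ℕ) * (Real.log 2 - Real.binEntropy s) * (1 - δ) ≤
      n * (lam * ((b * b : ℕ) * (128 * Real.exp (-(2 * lam * A.card))))) + Real.log 2 := by
  classical
  have hdisjBC : Disjoint B C := Finset.disjoint_left.mpr fun i hi hj => lt_irrefl i (hBC i hi i hj)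
  have hcardL : (B ∪ C).card = 2 * b := by
    rw [Finset.card_union_of_disjoint hdisjBC, hB, hC, two_mul]
  have hdisj : ∀ S ⊆ B ×ˢ C, Disjoint (A ×ˢ (B ∪ C)) S := by
    refine fun S hS => Finset.disjoint_left.mpr fun e he he' => ?_
    have h1 := (Finset.mem_product.mp he).1
    have h2 := (Finset.mem_product.mp (hS he')).1
    exact lt_irrefl _ (hA _ h1 _ (Finset.mem_union_left C h2))
  have hcardN : (B ×ˢ C).card = b * b := by rw [Finset.card_product, hB, hC]
  have hpairs : ∀ S ⊆ B ×ˢ C, pairs (ofPairs (A ×ˢ (B ∪ C) ∪ S)) = A ×ˢ (B ∪ C) ∪ S := by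
    refine fun S hS => pairs_ofPairs fun e he => ?_
    rcases Finset.mem_union.mp he with h | h
    · exact lt_of_mem_product hA e h
    · exact lt_of_mem_product hBC e (hS h)
  refine fano (s := (B ×ˢ C).powerset) (lam := lam) (est := est) (q := q)
    (Finset.powerset_nonempty _)
    (fun S => ofPairs (A ×ˢ (B ∪ C) ∪ S)) (ofPairs (A ×ˢ (B ∪ C)))
    (mul_nonneg (Nat.cast_nonneg _) (sub_nonneg.mpr Real.binEntropy_le_log_two)) ?_ ?_ ?_
  · intro S hS
    rw [Finset.mem_powerset] at hS
    refine (errorProb_le_maxErrorProb lam est q ?_).trans herr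
    rw [edgeBoundedClass, Set.mem_ofPred_eq, ncard_edgeSet_eq_card, hpairs S hS]
    refine (Finset.card_union_le _ _).trans (le_trans ?_ hk)
    rw [Finset.card_product, hcardL]
    exact Nat.add_le_add_left (hcardN ▸ Finset.card_le_card hS) _
  · intro S hS
    rw [Finset.mem_powerset] at hS
    have hbase := pairs_ofPairs (lt_of_mem_product hA)
    refine (relEntropy_le_of_pairs_eq_union (S := S) (by rw [hpairs S hS, hbase])
      (by rw [hbase]; exact hdisj S hS) hlam
      (ε := 128 * Real.exp (-(2 * lam * A.card))) fun e he => ?_).trans ?_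
    · obtain ⟨h1, h2⟩ := Finset.mem_product.mp (hS he)
      exact mean_one_sub_spin_mul_spin_le hA (hcardL ▸ hAb) (Finset.mem_union_left C h1)
        (Finset.mem_union_right B h2) (hBC _ h1 _ h2).ne lam
    · have : S.card ≤ b * b := hcardN ▸ Finset.card_le_card hS
      gcongr
  · intro H
    have h1 : ((B ×ˢ C).powerset.filter fun S =>
        editDist (ofPairs (A ×ˢ (B ∪ C) ∪ S)) H ≤ q).card ≤
        ((B ×ˢ C).powerset.filter fun S => (symmDiff S (pairs H ∩ B ×ˢ C)).card ≤ q).card := by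
      refine Finset.card_le_card fun S hS => ?_
      rw [Finset.mem_filter] at hS ⊢
      obtain ⟨hS, hdist⟩ := hS
      have hSN := Finset.mem_powerset.mp hS
      rw [editDist_eq_card, hpairs S hSN] at hdist
      refine ⟨hS, le_trans (Finset.card_le_card fun e he => ?_) hdist⟩
      have hnot : e ∈ B ×ˢ C → e ∉ A ×ˢ (B ∪ C) := fun h h' =>
        Finset.disjoint_left.mp (hdisj _ subset_rfl) h' h
      have hSe := @hSN e
      simp only [Finset.mem_symmDiff, Finset.mem_inter, Finset.mem_union] at he ⊢
      tauto
    have h2 := card_filter_card_le_exp (B ×ˢ C) hs0 hs (hcardN ▸ hq)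
    have h3 : (((B ×ˢ C).powerset.filter fun S =>
        editDist (ofPairs (A ×ˢ (B ∪ C) ∪ S)) H ≤ q).card : ℝ) ≤
        ((B ×ˢ C).powerset.filter fun W => W.card ≤ q).card := by
      exact_mod_cast h1.trans (card_symmDiff_ball_le _ _ q)
    refine h3.trans (h2.trans (le_of_eq ?_))
    rw [Finset.card_powerset, hcardN]
    push_cast
    rw [← Real.exp_log (show (0 : ℝ) < 2 ^ (b * b) by positivity), Real.log_pow, ← Real.exp_add]
    congr 1
    push_cast
    ring

/-- Consecutive blocks of vertices of prescribed sizes. -/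
theorem exists_blocks {p a b : ℕ} (h : a + 2 * b ≤ p) : ∃ A B C : Finset (Fin p),
    (∀ i ∈ A, ∀ l ∈ B ∪ C, i < l) ∧ (∀ i ∈ B, ∀ j ∈ C, i < j) ∧
      A.card = a ∧ B.card = b ∧ C.card = b := by
  refine ⟨(Finset.Ico 0 a).attachFin fun m hm => ?_,
    (Finset.Ico a (a + b)).attachFin fun m hm => ?_,
    (Finset.Ico (a + b) (a + 2 * b)).attachFin fun m hm => ?_, ?_, ?_, ?_, ?_, ?_⟩
  all_goals try rw [Finset.mem_Ico] at hm
  · omega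
  · omega
  · omega
  · intro i hi l hl
    simp only [Finset.mem_union, Finset.mem_attachFin, Finset.mem_Ico] at hi hl
    rw [Fin.lt_def]
    omega
  · intro i hi l hl
    simp only [Finset.mem_attachFin, Finset.mem_Ico] at hi hl
    rw [Fin.lt_def]
    omega
  · simp [Finset.card_attachFin]
  · simp [Finset.card_attachFin]
  · rw [Finset.card_attachFin, Nat.card_Ico]
    omega

/-- The sizes of the dense ensemble: `2 * a * b` fixed edges and `b ^ 2 ≥ k / 2` optional ones. -/
theorem exists_block_sizes {k : ℕ} (hk : 200 ≤ k) : ∃ a b : ℕ, a ≤ 2 * b ∧ a + 2 * b ≤ k ∧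
    a * (2 * b) + b * b ≤ k ∧ (k : ℝ) / 2 ≤ (b * b : ℕ) ∧ √((k : ℝ) / 2) / 2 ≤ 2 * a := by
  set y := √((k : ℝ) / 2)
  have hk' : (200 : ℝ) ≤ k := by exact_mod_cast hk
  have hy2 : y * y = k / 2 := Real.mul_self_sqrt (by positivity)
  have hy : 10 ≤ y := Real.le_sqrt_of_sq_le (by linarith)
  set b := ⌈y⌉₊
  have hb1 : y ≤ b := Nat.le_ceil y
  have hb2 : (b : ℝ) < y + 1 := Nat.ceil_lt_add_one (by linarith)
  have hb10 : 10 ≤ b := by exact_mod_cast hy.trans hb1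
  obtain ⟨a, ha1, ha2⟩ : ∃ a : ℕ, b ≤ 4 * a ∧ 4 * a ≤ b + 3 := ⟨(b + 3) / 4, by omega, by omega⟩
  have ha1' : (b : ℝ) ≤ 4 * a := by exact_mod_cast ha1
  have ha2' : (4 * a : ℝ) ≤ b + 3 := by exact_mod_cast ha2
  have hedges : a * (2 * b) + b * b ≤ k := by
    have : (a * (2 * b) + b * b : ℝ) ≤ k := by
      calc (a * (2 * b) + b * b : ℝ) ≤ (b + 3) / 4 * (2 * b) + b * b := by gcongr; linarith
        _ = 3 / 2 * (b * (b + 1)) := by ring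
        _ ≤ 3 / 2 * ((y + 1) * (y + 2)) := by nlinarith
        _ ≤ k := by nlinarith
    exact_mod_cast this
  refine ⟨a, b, by omega, ?_, hedges, ?_, by linarith⟩
  · nlinarith
  · push_cast
    nlinarith

theorem exp_bound_le {n k p : ℕ} {lam δ θ : ℝ} {est : Estimator n p} (hθ : θ ∈ Set.Ioo 0 (1 / 4))
    (hk : 200 ≤ k) (hkp : k ≤ p) (hlam : 0 < lam)
    (herr : maxErrorProb (edgeBoundedClass p k) lam est ⌊θ * (k : ℝ)⌋₊ ≤ δ) :
    Real.exp (lam * (√((k : ℝ) / 2) - 2) / 2) * (Real.log 2 - Real.binEntropy (2 * θ)) /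
        (6 * lam * (k : ℝ)) *
      (1 - δ - 2 * Real.log 2 / ((Real.log 2 - Real.binEntropy (2 * θ)) * k)) ≤ n := by
  obtain ⟨a, b, hab, hp, hedges, hopt, ha⟩ := exists_block_sizes hk
  obtain ⟨A, B, C, hA, hBC, rfl, hB, hC⟩ := exists_blocks (hp.trans hkp)
  have hk' : (200 : ℝ) ≤ k := by exact_mod_cast hk
  have hθ1 := hθ.1
  have hθ2 := hθ.2
  have hfloor : ((⌊θ * (k : ℝ)⌋₊ : ℕ) : ℝ) ≤ 2 * θ * (b * b : ℕ) :=
    (Nat.floor_le (by positivity)).trans (by nlinarith)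
  have h := fano_dense (n := n) (est := est) hA hBC hB hC hab hedges hlam.le
    (by linarith : 0 < 2 * θ) (by linarith) hfloor herr
  have hc : 0 < Real.log 2 - Real.binEntropy (2 * θ) :=
    sub_pos.mpr (Real.binEntropy_lt_log_two.mpr (by norm_num; linarith))
  set c := Real.log 2 - Real.binEntropy (2 * θ)
  set N : ℝ := ((b * b : ℕ) : ℝ)
  set y := √((k : ℝ) / 2)
  have hl2 : 0 < Real.log 2 := Real.log_pos one_lt_two
  have hN : 0 < N := by linarith
  rcases le_total (1 - δ - 2 * Real.log 2 / (c * k)) 0 with hneg | hpos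
  · exact (mul_nonpos_of_nonneg_of_nonpos (by positivity) hneg).trans (Nat.cast_nonneg n)
  have h1 : c * (1 - δ - 2 * Real.log 2 / (c * k)) ≤
      n * lam * 128 * Real.exp (-(2 * lam * A.card)) := by
    have h2 : c * (2 * Real.log 2 / (c * k)) = Real.log 2 / (k / 2) := by field_simp
    have h3 : Real.log 2 / N ≤ Real.log 2 / (k / 2) := by gcongr
    have h4 : c * (1 - δ) ≤ n * lam * 128 * Real.exp (-(2 * lam * A.card)) + Real.log 2 / N := by
      refine le_of_mul_le_mul_left ?_ hN
      have h5 : N * (Real.log 2 / N) = Real.log 2 := mul_div_cancel₀ _ hN.ne'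
      linarith
    rw [mul_sub, h2]
    linarith
  have h2 : Real.exp (lam * (y - 2) / 2) ≤ Real.exp (2 * lam * A.card) := by
    refine Real.exp_le_exp.mpr ?_
    nlinarith
  calc Real.exp (lam * (y - 2) / 2) * c / (6 * lam * k) * (1 - δ - 2 * Real.log 2 / (c * k))
      = Real.exp (lam * (y - 2) / 2) / (6 * lam * k) *
          (c * (1 - δ - 2 * Real.log 2 / (c * k))) := by ring
    _ ≤ Real.exp (2 * lam * A.card) / (128 * lam) *
          (n * lam * 128 * Real.exp (-(2 * lam * A.card))) := by
        refine mul_le_mul ?_ h1 (by positivity) (by positivity)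
        refine div_le_div₀ (by positivity) h2 (by positivity) ?_
        nlinarith
    _ = n := by
        rw [Real.exp_neg]
        field_simp

end IsingRecovery

end

theorem theorem1 (θ : ℝ) (hθ : θ ∈ Set.Ioo (0 : ℝ) (1 / 4)) :
    ∃ η : ℕ → ℝ, Tendsto η atTop (𝓝 0) ∧
      ∀ (k p n : ℕ) (lam δ : ℝ), 0 < k → (k : ℝ) ≤ (p : ℝ) / 4 → 0 < lam →
        ∀ est : IsingRecovery.Estimator n p,
          IsingRecovery.maxErrorProb (IsingRecovery.edgeBoundedClass p k) lam est ⌊θ * (k : ℝ)⌋₊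
              ≤ δ →
            max
                (Real.exp (lam * (√((k : ℝ) / 2) - 2) / 2) *
                    (Real.log 2 - Real.binEntropy (2 * θ)) / (6 * lam * (k : ℝ)))
                (2 * (1 - θ) * Real.log (p : ℝ) / (lam * Real.tanh lam)) *
              (1 - δ - η k) ≤ (n : ℝ) := by
  have hc : 0 < Real.log 2 - Real.binEntropy (2 * θ) :=
    sub_pos.mpr (Real.binEntropy_lt_log_two.mpr (by linarith [hθ.2]))
  have hl2 : 0 < Real.log 2 := Real.log_pos one_lt_two
  -- The first term makes the bound trivial for the small `k`, to which the ensembles do not apply.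
  refine ⟨fun k => (if k < 200 then 1 else 0) +
    2 * Real.log 2 / ((Real.log 2 - Real.binEntropy (2 * θ)) * k) +
    4 * Real.log 2 / Real.log (4 * (k : ℝ)), ?_, ?_⟩
  · have h1 : Tendsto (fun k : ℕ => if k < 200 then (1 : ℝ) else 0) atTop (𝓝 0) :=
      tendsto_const_nhds.congr' <| (eventually_ge_atTop 200).mono fun k hk =>
        (if_neg (not_lt.mpr hk)).symm
    have hcast := tendsto_natCast_atTop_atTop (R := ℝ)
    have h2 := (hcast.const_mul_atTop hc).const_div_atTop (2 * Real.log 2)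
    have h3 := (Real.tendsto_log_atTop.comp
      (hcast.const_mul_atTop (by norm_num : (0 : ℝ) < 4))).const_div_atTop (4 * Real.log 2)
    simpa using (h1.add h2).add h3
  intro k p n lam δ hk hkp hlam est herr
  have hδ : 0 ≤ δ :=
    (IsingRecovery.maxErrorProb_edgeBoundedClass_nonneg k lam est _).trans herr
  have hk1 : (1 : ℝ) ≤ k := by exact_mod_cast hk
  have hkp' : 4 * k ≤ p := by
    have : (4 * k : ℝ) ≤ p := by linarith
    exact_mod_cast this
  have hη1 : 0 ≤ 2 * Real.log 2 / ((Real.log 2 - Real.binEntropy (2 * θ)) * k) := by positivity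
  have hη2 : 0 ≤ 4 * Real.log 2 / Real.log (4 * (k : ℝ)) :=
    div_nonneg (by positivity) (Real.log_nonneg (by linarith))
  have hX : 0 ≤ Real.exp (lam * (√((k : ℝ) / 2) - 2) / 2) *
      (Real.log 2 - Real.binEntropy (2 * θ)) / (6 * lam * (k : ℝ)) := by positivity
  have hY : 0 ≤ 2 * (1 - θ) * Real.log (p : ℝ) / (lam * Real.tanh lam) :=
    div_nonneg (mul_nonneg (by linarith [hθ.2]) (Real.log_natCast_nonneg p))
      (mul_nonneg hlam.le (IsingRecovery.tanh_pos hlam).le)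
  by_cases hsmall : k < 200
  · refine (mul_nonpos_of_nonneg_of_nonpos (le_max_of_le_left hX) ?_).trans (Nat.cast_nonneg n)
    simp only [hsmall, if_true]
    linarith
  · rw [not_lt] at hsmall
    simp only [not_lt.mpr hsmall, if_false, zero_add]
    rcases max_choice
      (Real.exp (lam * (√((k : ℝ) / 2) - 2) / 2) *
        (Real.log 2 - Real.binEntropy (2 * θ)) / (6 * lam * (k : ℝ)))
      (2 * (1 - θ) * Real.log (p : ℝ) / (lam * Real.tanh lam)) with h | h
    · rw [h]
      exact (mul_le_mul_of_nonneg_left (by linarith) hX).trans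
        (IsingRecovery.exp_bound_le hθ hsmall (by omega) hlam herr)
    · rw [h]
      exact (mul_le_mul_of_nonneg_left (by linarith) hY).trans
        (IsingRecovery.log_bound_le hθ (by omega) hkp' hlam herr)
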